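/- A field $K$ is called ample (or large) if every smooth curve $C$ over $K$ that has a $K$-rational point has infinitely many $K$-rational points; here a curve over $K$ is a one-dimensional, geometrically irreducible and geometrically reduced, separated scheme of finite type over $K$. Let $K$ be a perfect ample field, and let $X \subseteq K$ be an infinite set that is existentially $K$-definable, i.e. $X = \{x \in K : K \models \varphi(x)\}$ for some existential first-order formula $\varphi(x)$ in the language of rings with parameters from $K$. Then $$|X \setminus K_1| = |K|$$ for every proper subfield $K_1$ of $K$, where $|\cdot|$ denotes cardinality. -/

import Mathlib

universe u v w

open AlgebraicGeometry CategoryTheory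

/-- The `K`-rational points of a `K`-scheme `f : C ⟶ Spec K`, i.e. the sections of `f`. -/
abbrev RationalPoints {K : Type u} [Field K] {C : Scheme.{u}} (f : C ⟶ Spec (CommRingCat.of K)) :
    Type u :=
  {s : Spec (CommRingCat.of K) ⟶ C // s ≫ f = 𝟙 (Spec (CommRingCat.of K))}

/-- A smooth curve over the field `K`: a separated scheme of finite type over `K` that is
geometrically integral and smooth of relative dimension one (local finiteness is part of
smoothness). -/
structure IsSmoothCurve {K : Type u} [Field K] {C : Scheme.{u}}
    (f : C ⟶ Spec (CommRingCat.of K)) : Prop where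
  isSeparated : IsSeparated f
  quasiCompact : QuasiCompact f
  geometricallyIntegral : GeometricallyIntegral f
  smooth : SmoothOfRelativeDimension 1 f

/-- A field `K` is ample (or large) if every smooth curve over `K` that has a `K`-rational point
has infinitely many of them. -/
def IsAmpleField (K : Type u) [Field K] : Prop :=
  ∀ (C : Scheme.{u}) (f : C ⟶ Spec (CommRingCat.of K)), IsSmoothCurve f →
    Nonempty (RationalPoints f) → Infinite (RationalPoints f)

/-- A subset `X` of an `L`-structure `M` is existentially `A`-definable if it is the set of all
`x` satisfying some existential `L`-formula `φ(x)` with parameters from `A`. -/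
def IsExistentiallyDefinable (L : FirstOrder.Language.{v, w}) {M : Type u} [L.Structure M] (A X : Set M) :
    Prop :=
  ∃ φ : L.Formula (A ⊕ Unit), FirstOrder.Language.BoundedFormula.IsExistential φ ∧
    X = {x : M | φ.Realize (Sum.elim (fun a : A => (a : M)) (fun _ => x))}

section

open scoped Polynomial PowerSeries TensorProduct

/-! An existential set is the set of values of a function `x` at the `K`-points of a finitely
generated algebra `D`. If it is infinite, `x` becomes transcendental in a perfect extension `Ω` of
`K`, a quotient of `K^X`, in which `K` is existentially closed. Separating transcendence bases over
the perfect closure of `K(x)`, a descent to polynomial rings and a specialization at a `K`-point map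
`D` to an étale `K[X]`-algebra `A` that has a `K`-point, with `x ↦ X ^ p ^ k`
(`exists_etale_polynomial`). Frobenius being bijective on `K`, it remains to count the values of the
coordinate `X` on `A(K)`.

Let `a` be one such value. Finitely many pullbacks of `A` along `X ↦ a + γ X` have a common étale
neighbourhood with a point over `0`. Near that point it embeds in `K⟦X⟧`, so it is geometrically
integral, and ampleness gives a point over some `s ≠ 0`: all `a + γ s` are values. Choose the slopes
`α^i` and `α^i β` for `i < 3`, with `α ∉ K₁`. In each triple some value lies outside `K₁`, and the
two values and their exponents determine `β`. Hence `K` is covered by pairs of values outside `K₁`,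
up to finite data. -/

/-! ### Rational points of étale algebras over the affine line. -/

theorem Polynomial.isStandardSmoothOfRelativeDimension_one (R : Type*) [CommRing R] [Nontrivial R] :
    Algebra.IsStandardSmoothOfRelativeDimension 1 R R[X] := by
  let b : Module.Basis Unit R[X] Ω[R[X]⁄R] :=
    (Module.Basis.singleton Unit R[X]).map (KaehlerDifferential.polynomialEquiv R).symm
  have hb : Set.range b ⊆ Set.range (KaehlerDifferential.D R R[X]) := by
    rintro _ ⟨i, rfl⟩
    exact ⟨Polynomial.X, by simp [b]⟩
  have := Algebra.IsStandardSmooth.of_basis_kaehlerDifferential b hb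
  rw [Algebra.IsStandardSmoothOfRelativeDimension.iff_of_isStandardSmooth,
    rank_eq_card_basis b]
  simp

/-- A subalgebra of a power series ring over a field stays a domain after any extension of
the base field. -/
theorem PowerSeries.isDomain_tensorProduct {K B L : Type*} [Field K] [CommRing B] [Algebra K B]
    [Field L] [Algebra K L] (f : B →ₐ[K] K⟦X⟧) (hf : Function.Injective f) :
    IsDomain (B ⊗[K] L) := by
  let g : B →ₐ[K] L⟦X⟧ := (PowerSeries.mapAlgHom (Algebra.ofId K L)).comp f
  let h : L →ₐ[K] L⟦X⟧ := IsScalarTower.toAlgHom K L L⟦X⟧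
  let F : B ⊗[K] L →ₐ[K] L⟦X⟧ := Algebra.TensorProduct.lift g h fun _ _ => Commute.all _ _
  suffices hF : Function.Injective F from hF.isDomain F.toRingHom
  rw [injective_iff_map_eq_zero]
  intro z hz
  -- In a `K`-basis of `L`, the vanishing of a power series coefficient is a `K`-linear relation
  -- among basis vectors.
  let b := Module.Basis.ofVectorSpace K L
  obtain ⟨c, rfl⟩ := TensorProduct.eq_repr_basis_right b z
  suffices hc : c = 0 by simp [hc]
  ext i
  refine hf (PowerSeries.ext fun n => ?_)
  have hn := congrArg (PowerSeries.coeff n) hz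
  have hF (m : B) (l : L) : PowerSeries.coeff n (F (m ⊗ₜ l)) = PowerSeries.coeff n (f m) • l := by
    have : PowerSeries.mapAlgHom (Algebra.ofId K L) (f m) = PowerSeries.map (algebraMap K L) (f m) :=
      rfl
    simp [F, g, h, Algebra.smul_def, this]
  rw [Finsupp.sum, map_sum, map_sum] at hn
  simp only [hF, map_zero] at hn
  by_cases hi : i ∈ c.support
  · simpa using linearIndependent_iff'.mp b.linearIndependent c.support
      (fun i => PowerSeries.coeff n (f (c i))) hn i hi
  · simp [Finsupp.notMem_support_iff.mp hi]

theorem IsAmpleField.infinite_algHom {K : Type u} [Field K] (hK : IsAmpleField K) {B : Type u}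
    [CommRing B] [Algebra K B] [Algebra K[X] B] [IsScalarTower K K[X] B] [Algebra.Etale K[X] B]
    (f : B →ₐ[K] K⟦X⟧) (hf : Function.Injective f) : Infinite (B →ₐ[K] K) := by
  let φ : Spec (CommRingCat.of B) ⟶ Spec (CommRingCat.of K) :=
    Spec.map (CommRingCat.ofHom (algebraMap K B))
  have hcurve : IsSmoothCurve φ := by
    refine ⟨inferInstance, inferInstance, ⟨?_⟩, ?_⟩
    · rw [geometrically_iff_of_commRing]
      intro L _ _ Y fst snd h
      have := PowerSeries.isDomain_tensorProduct (L := L) f hf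
      have : IsIntegral (Spec (CommRingCat.of (B ⊗[K] L))) := inferInstance
      have : Nonempty Y := ⟨(h.isoPullback ≪≫ pullbackSpecIso K B L).inv (Classical.arbitrary _)⟩
      exact isIntegral_of_isOpenImmersion (h.isoPullback ≪≫ pullbackSpecIso K B L).hom
    · have := Polynomial.isStandardSmoothOfRelativeDimension_one K
      have : Algebra.IsStandardSmoothOfRelativeDimension 0 K[X] B :=
        Algebra.Etale.iff_isStandardSmoothOfRelativeDimension_zero.mp inferInstance
      have := Algebra.IsStandardSmoothOfRelativeDimension.trans 1 0 K K[X] B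
      rw [HasRingHomProperty.Spec_iff (P := @SmoothOfRelativeDimension 1)]
      refine RingHom.locally_of RingHom.isStandardSmoothOfRelativeDimension_respectsIso _ ?_
      exact (RingHom.isStandardSmoothOfRelativeDimension_algebraMap 1).mpr this
  have key (s : RationalPoints φ) : ∃ g : B →ₐ[K] K, s.1 = Spec.map (CommRingCat.ofHom g.toRingHom) := by
    obtain ⟨s, hs⟩ := s
    obtain ⟨g, rfl⟩ := Spec.map_surjective s
    rw [← Spec.map_comp, ← Spec.map_id] at hs
    have := congrArg CommRingCat.Hom.hom (Spec.map_injective hs)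
    exact ⟨⟨g.hom, fun r => congrArg (fun t => t r) this⟩, rfl⟩
  choose G hG using key
  have : Infinite (RationalPoints φ) := by
    refine hK _ φ hcurve ⟨⟨Spec.map (CommRingCat.ofHom
      ((PowerSeries.constantCoeff (R := K)).comp f.toRingHom)), ?_⟩⟩
    rw [← Spec.map_comp, ← Spec.map_id, ← CommRingCat.ofHom_comp]
    congr 1
    ext r
    simp
  refine Infinite.of_injective G fun s t h => Subtype.ext ?_
  rw [hG, hG, h]

theorem PowerSeries.exists_algHom_of_X_pow_eq_zero {K S : Type*} [CommRing K] [CommRing S]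
    [Algebra K[X] S] {n : ℕ} (hn : algebraMap K[X] S Polynomial.X ^ n = 0) :
    ∃ ρ : K⟦X⟧ →ₐ[K[X]] S, ∀ f, ρ f = algebraMap K[X] S (PowerSeries.trunc n f) := by
  have trunc_coe (p : K[X]) :
      algebraMap K[X] S (PowerSeries.trunc n (p : K⟦X⟧)) = algebraMap K[X] S p := by
    have : (Polynomial.X : K[X]) ^ n ∣ p - PowerSeries.trunc n (p : K⟦X⟧) := by
      rw [Polynomial.X_pow_dvd_iff]
      intro d hd
      simp [PowerSeries.coeff_trunc, hd]
    obtain ⟨q, hq⟩ := this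
    have := congrArg (algebraMap K[X] S) hq
    rw [map_mul, map_pow, hn, zero_mul, map_sub, sub_eq_zero] at this
    exact this.symm
  let ρ : K⟦X⟧ →+* S :=
    { toFun f := algebraMap K[X] S (PowerSeries.trunc n f)
      map_one' := by simpa using trunc_coe 1
      map_zero' := by simp
      map_add' f g := by simp
      map_mul' f g := by
        rw [← map_mul, ← trunc_coe (_ * _), Polynomial.coe_mul,
          PowerSeries.trunc_trunc_mul_trunc] }
  exact ⟨⟨ρ, fun p => trunc_coe p⟩, fun _ => rfl⟩

/-- Truncation maps `K⟦X⟧` to `B ⧸ m ^ (n + 1)`. Composed with `Φ` it agrees with the quotient map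
modulo the nilpotent ideal `m`, hence everywhere by unramifiedness. The exponent `n + 1` keeps `m ^
(n + 1) ≤ m` when `n = 0`. -/
theorem Algebra.FormallyUnramified.ker_le_pow {K B : Type u} [Field K] [CommRing B] [Algebra K[X] B]
    [Algebra.FormallyUnramified K[X] B]
    (Φ : B →ₐ[K[X]] K⟦X⟧) (n : ℕ) :
    RingHom.ker Φ ≤ (RingHom.ker (PowerSeries.constantCoeff.comp Φ.toRingHom)) ^ n := by
  set m := RingHom.ker (PowerSeries.constantCoeff.comp Φ.toRingHom)
  have hX : algebraMap K[X] B Polynomial.X ∈ m := by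
    simp [m, RingHom.mem_ker, PowerSeries.algebraMap_apply']
  have hn : algebraMap K[X] (B ⧸ m ^ (n + 1)) Polynomial.X ^ (n + 1) = 0 := by
    rw [IsScalarTower.algebraMap_apply K[X] B, ← map_pow]
    exact Ideal.Quotient.eq_zero_iff_mem.mpr (Ideal.pow_mem_pow hX _)
  obtain ⟨ρ, hρ⟩ := PowerSeries.exists_algHom_of_X_pow_eq_zero hn
  have hle : m ^ (n + 1) ≤ m := Ideal.pow_le_self (by simp)
  have key : ρ.comp Φ = Ideal.Quotient.mkₐ K[X] (m ^ (n + 1)) := by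
    refine Algebra.FormallyUnramified.ext' (Ideal.Quotient.factor hle) ?_ _ _ fun b => ?_
    · refine ⟨n + 1, ?_⟩
      rw [Ideal.Quotient.factor_ker, ← Ideal.map_pow]
      simp
    · change Ideal.Quotient.factor hle (ρ (Φ b)) = Ideal.Quotient.mk m b
      have hX' : (Polynomial.X : K[X]) ∣ PowerSeries.trunc (n + 1) (Φ b) -
          Polynomial.C (PowerSeries.constantCoeff (Φ b)) := by
        rw [Polynomial.X_dvd_iff]
        simp [PowerSeries.coeff_trunc]
      obtain ⟨q, hq⟩ := hX'
      rw [hρ, IsScalarTower.algebraMap_apply K[X] B, Ideal.Quotient.algebraMap_eq,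
        Ideal.Quotient.factor_mk, sub_eq_iff_eq_add.mp hq, map_add, map_mul, map_add, map_mul,
        Ideal.Quotient.eq_zero_iff_mem.mpr hX, zero_mul, zero_add, Ideal.Quotient.eq,
        RingHom.mem_ker]
      simp [PowerSeries.algebraMap_apply']
  intro b hb
  have := congrArg (fun t => t b) key
  have hb' : Φ b = 0 := hb
  simp only [AlgHom.comp_apply, hb', map_zero] at this
  exact Ideal.pow_le_pow_right (Nat.le_succ n) (Ideal.Quotient.eq_zero_iff_mem.mp this.symm)

section EtaleOverLine

variable {K B : Type u} [Field K] [CommRing B] [Algebra K B] [Algebra K[X] B]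
  [IsScalarTower K K[X] B]

/-- Taylor expansion at a point over `0`: `K⟦X⟧` is `X`-adically complete, so the point lifts along
`K⟦X⟧ → K`. -/
theorem Algebra.FormallySmooth.exists_algHom_powerSeries [Algebra.FormallySmooth K[X] B]
    (ψ : B →ₐ[K] K) (hψ : ψ (algebraMap K[X] B Polynomial.X) = 0) :
    ∃ Φ : B →ₐ[K[X]] K⟦X⟧, ∀ b, PowerSeries.constantCoeff (Φ b) = ψ b := by
  let I : Ideal K⟦X⟧ := .span {PowerSeries.X}
  have hψ' (p : K[X]) : ψ (algebraMap K[X] B p) = p.coeff 0 := by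
    have : ψ.comp (IsScalarTower.toAlgHom K K[X] B) = Polynomial.aeval 0 :=
      Polynomial.algHom_ext (by simpa using hψ)
    simpa [Polynomial.coeff_zero_eq_aeval_zero] using congrArg (fun t => t p) this
  let f : B →ₐ[K[X]] K⟦X⟧ ⧸ I :=
    { __ := (algebraMap K (K⟦X⟧ ⧸ I)).comp ψ.toRingHom
      commutes' p := by
        change algebraMap K (K⟦X⟧ ⧸ I) (ψ (algebraMap K[X] B p)) = _
        rw [hψ', IsScalarTower.algebraMap_apply K K⟦X⟧, IsScalarTower.algebraMap_apply K[X] K⟦X⟧,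
          Ideal.Quotient.algebraMap_eq, Ideal.Quotient.eq, Ideal.mem_span_singleton,
          PowerSeries.X_dvd_iff]
        simp [PowerSeries.algebraMap_apply'] }
  obtain ⟨Φ, hΦ⟩ := Algebra.FormallySmooth.exists_mkₐ_comp_eq_of_isAdicComplete f
  refine ⟨Φ, fun b => ?_⟩
  have h : Ideal.Quotient.mk I (Φ b) = Ideal.Quotient.mk I (PowerSeries.C (ψ b)) :=
    congrArg (fun t => t b) hΦ
  rw [Ideal.Quotient.eq, Ideal.mem_span_singleton, PowerSeries.X_dvd_iff] at h
  simpa [sub_eq_zero] using h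

/-- The fibre over `0` is unramified of finite type over `K`, hence finite-dimensional. -/
theorem Algebra.FormallyUnramified.finite_algHom_eq_zero [Algebra.FormallyUnramified K[X] B]
    [Algebra.FiniteType K[X] B] :
    {g : B →ₐ[K] K | g (algebraMap K[X] B Polynomial.X) = 0}.Finite := by
  let I : Ideal B := .span {algebraMap K[X] B Polynomial.X}
  let := (Polynomial.evalRingHom (0 : K)).toAlgebra
  have tower : IsScalarTower K[X] K (B ⧸ I) := by
    refine .of_algebraMap_eq' (Polynomial.ringHom_ext (fun a => ?_) ?_)
    · change algebraMap K[X] (B ⧸ I) (algebraMap K K[X] a) =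
        algebraMap K (B ⧸ I) (Polynomial.eval 0 (Polynomial.C a))
      rw [← IsScalarTower.algebraMap_apply, Polynomial.eval_C]
    · change algebraMap K[X] (B ⧸ I) Polynomial.X = algebraMap K (B ⧸ I) (Polynomial.eval 0 Polynomial.X)
      rw [IsScalarTower.algebraMap_apply K[X] B, Polynomial.eval_X, map_zero]
      exact Ideal.Quotient.eq_zero_iff_mem.mpr (Ideal.mem_span_singleton_self _)
  have : Algebra.FormallyUnramified B (B ⧸ I) := .quotient _
  have : Algebra.FormallyUnramified K[X] (B ⧸ I) := .comp _ B _
  have : Algebra.FormallyUnramified K (B ⧸ I) := .of_restrictScalars K[X] _ _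
  have : Algebra.FiniteType K[X] (B ⧸ I) := .trans (S := B) inferInstance inferInstance
  have : Algebra.FiniteType K (B ⧸ I) := .of_restrictScalars_finiteType K[X] _ _
  have : Module.Finite K (B ⧸ I) := Algebra.FormallyUnramified.finite_of_free K _
  have hfin : Finite ((B ⧸ I) →ₐ[K] K) := inferInstance
  refine (Set.finite_range fun g : (B ⧸ I) →ₐ[K] K => g.comp (Ideal.Quotient.mkₐ K I)).subset ?_
  intro g hg
  refine ⟨Ideal.Quotient.liftₐ I g fun b hb => ?_, AlgHom.ext fun b => rfl⟩
  have : I ≤ RingHom.ker g := by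
    rw [Ideal.span_singleton_le_iff_mem]
    exact hg
  exact this hb

theorem IsAmpleField.exists_algHom_ne_zero (hK : IsAmpleField K) [Algebra.Etale K[X] B]
    (ψ : B →ₐ[K] K) (hψ : ψ (algebraMap K[X] B Polynomial.X) = 0) :
    ∃ g : B →ₐ[K] K, g (algebraMap K[X] B Polynomial.X) ≠ 0 := by
  obtain ⟨Φ, hΦ⟩ := Algebra.FormallySmooth.exists_algHom_powerSeries ψ hψ
  have : IsNoetherianRing B := Algebra.FiniteType.isNoetherianRing K[X] B
  set m := RingHom.ker (PowerSeries.constantCoeff.comp Φ.toRingHom) with hm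
  -- Krull's intersection theorem and Nakayama: one `r ∈ m` fixes the whole kernel. Inverting `1 -
  -- r`, which is nonzero at the point, kills the kernel and leaves a neighbourhood embedded in
  -- `K⟦X⟧`.
  obtain ⟨r, hrm, hr⟩ := Submodule.exists_mem_and_smul_eq_self_of_fg_of_le_smul m (RingHom.ker Φ)
    (IsNoetherian.noetherian _) (fun x hx => by
      obtain ⟨r, hr⟩ := (m.mem_iInf_smul_pow_eq_bot_iff x).mp (by
        rw [Submodule.mem_iInf]
        intro n
        rw [smul_eq_mul, Ideal.mul_top]
        exact Algebra.FormallyUnramified.ker_le_pow Φ n hx)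
      rw [← hr]
      exact Submodule.smul_mem_smul r.2 hx)
  have hunit : IsUnit (Φ (1 - r)) := by
    rw [PowerSeries.isUnit_iff_constantCoeff]
    have : PowerSeries.constantCoeff (Φ r) = 0 := hrm
    simp [this]
  let Φ' : Localization.Away (1 - r) →ₐ[K[X]] K⟦X⟧ :=
    IsLocalization.liftAlgHom (M := Submonoid.powers (1 - r)) (f := Φ) (by
      rintro ⟨_, n, rfl⟩
      simpa using hunit.pow n)
  have hΦ' : Function.Injective Φ' := by
    rw [injective_iff_map_eq_zero]
    intro z hz
    obtain ⟨b, s, rfl⟩ := IsLocalization.exists_mk'_eq (Submonoid.powers (1 - r)) z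
    have hb : Φ b = 0 := by
      have := congrArg Φ' (IsLocalization.mk'_spec (Localization.Away (1 - r)) b s)
      rw [map_mul, hz, zero_mul] at this
      simpa [Φ'] using this.symm
    rw [IsLocalization.mk'_eq_zero_iff]
    refine ⟨⟨1 - r, Submonoid.mem_powers _⟩, ?_⟩
    have := hr b hb
    rw [smul_eq_mul] at this
    simp [sub_mul, this]
  have : Infinite (Localization.Away (1 - r) →ₐ[K] K) :=
    hK.infinite_algHom (Φ'.restrictScalars K) hΦ'
  obtain ⟨g, hg⟩ := (Algebra.FormallyUnramified.finite_algHom_eq_zero (K := K)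
    (B := Localization.Away (1 - r))).exists_notMem
  refine ⟨g.comp (IsScalarTower.toAlgHom K B _), fun h => hg ?_⟩
  rw [Set.mem_ofPred_eq, IsScalarTower.algebraMap_apply K[X] B]
  exact h

end EtaleOverLine

/-! ### Simultaneous pullbacks along affine maps of the line. -/

theorem Algebra.Etale.exists_pushout {R A B : Type u} [CommRing R] [CommRing A] [CommRing B]
    [Algebra R A] [Algebra.Etale R A] (φ : R →+* B) :
    ∃ (C : Type u) (_ : CommRing C) (_ : Algebra B C) (j : A →+* C), Algebra.Etale B C ∧
      j.comp (algebraMap R A) = (algebraMap B C).comp φ ∧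
      ∀ {T : Type u} [CommRing T] (f : B →+* T) (g : A →+* T),
        g.comp (algebraMap R A) = f.comp φ →
        ∃ h : C →+* T, h.comp (algebraMap B C) = f ∧ h.comp j = g := by
  let := φ.toAlgebra
  refine ⟨B ⊗[R] A, inferInstance, inferInstance,
    (Algebra.TensorProduct.includeRight (R := R) (A := B) (B := A)).toRingHom, inferInstance, ?_, ?_⟩
  · ext r
    exact (Algebra.TensorProduct.includeRight (R := R) (A := B) (B := A)).commutes r |>.trans
      (IsScalarTower.algebraMap_apply R B (B ⊗[R] A) r)
  · intro T _ f g hfg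
    let := (f.comp φ).toAlgebra
    let f' : B →ₐ[R] T := ⟨f, fun _ => rfl⟩
    let g' : A →ₐ[R] T := ⟨g, fun r => congrArg (fun t => t r) hfg⟩
    let h := Algebra.TensorProduct.lift f' g' fun _ _ => Commute.all _ _
    refine ⟨h.toRingHom, ?_, ?_⟩
    · ext b
      change h (b ⊗ₜ 1) = f b
      simp [h, f']
    · ext c
      change h (1 ⊗ₜ c) = g c
      simp [h, g']

/-- An étale algebra over the affine line with a rational point over `a` admits, for every finite
list of slopes `γ`, a common étale algebra over the affine line with a rational point over `0` that
dominates all its pullbacks along `X ↦ a + γ X`. -/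
theorem Algebra.Etale.exists_common_pullback {K A : Type u} [Field K] [CommRing A] [Algebra K A]
    [Algebra K[X] A] [IsScalarTower K K[X] A] [Algebra.Etale K[X] A] (χ : A →ₐ[K] K)
    (l : List K) :
    ∃ (B : Type u) (_ : CommRing B) (_ : Algebra K B) (_ : Algebra K[X] B)
      (_ : IsScalarTower K K[X] B) (_ : Algebra.Etale K[X] B) (ψ : B →ₐ[K] K),
      ψ (algebraMap K[X] B Polynomial.X) = 0 ∧ ∀ γ ∈ l, ∃ j : A →ₐ[K] B,
        j (algebraMap K[X] A Polynomial.X) = algebraMap K[X] B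
          (Polynomial.C (χ (algebraMap K[X] A Polynomial.X)) +
            Polynomial.C γ * Polynomial.X) := by
  induction l with
  | nil =>
    exact ⟨K[X], inferInstance, inferInstance, inferInstance, inferInstance, inferInstance,
      Polynomial.aeval 0, by simp, by simp⟩
  | cons γ l ih =>
    obtain ⟨B, _, _, _, _, _, ψ, hψ, hB⟩ := ih
    set a := χ (algebraMap K[X] A Polynomial.X) with ha
    let p : K[X] := Polynomial.C a + Polynomial.C γ * Polynomial.X
    let φ : K[X] →ₐ[K] B := Polynomial.aeval (algebraMap K[X] B p)
    obtain ⟨C, _, _, j, hC, hj, hlift⟩ := Algebra.Etale.exists_pushout (A := A) φ.toRingHom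
    let := Algebra.compHom C (algebraMap K[X] B)
    let := Algebra.compHom C (algebraMap K B)
    have : IsScalarTower K B C := .of_algebraMap_eq fun _ => rfl
    have : IsScalarTower K[X] B C := .of_algebraMap_eq fun _ => rfl
    have : IsScalarTower K K[X] C := .of_algebraMap_eq fun r => by
      rw [IsScalarTower.algebraMap_apply K B C, IsScalarTower.algebraMap_apply K[X] B C,
        IsScalarTower.algebraMap_apply K K[X] B]
    have : Algebra.Etale K[X] C := .comp K[X] B C
    have hjp (q : K[X]) : j (algebraMap K[X] A q) = algebraMap B C (φ q) :=
      congrArg (fun t => t q) hj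
    have hψp (q : K[X]) : ψ (algebraMap K[X] B q) = q.eval 0 := by
      have : ψ.comp (IsScalarTower.toAlgHom K K[X] B) = Polynomial.aeval 0 :=
        Polynomial.algHom_ext (by simpa using hψ)
      simpa [Polynomial.coe_aeval_eq_eval] using congrArg (fun t => t q) this
    -- The affine map `X ↦ a + γ X` sends `0` to `a`, so `ψ` and `χ` glue to a point of the fibre
    -- product `C`.
    have hχφ : χ.comp (IsScalarTower.toAlgHom K K[X] A) = ψ.comp φ :=
      Polynomial.algHom_ext (by simp [φ, hψp, p, ← ha])
    obtain ⟨h, hh, -⟩ := hlift ψ.toRingHom χ.toRingHom (congrArg AlgHom.toRingHom hχφ)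
    have hhB (b : B) : h (algebraMap B C b) = ψ b := congrArg (fun t => t b) hh
    refine ⟨C, inferInstance, inferInstance, inferInstance, inferInstance, inferInstance,
      ⟨h, fun r => ?_⟩, ?_, ?_⟩
    · change h (algebraMap K C r) = _
      rw [IsScalarTower.algebraMap_apply K B C, hhB, ψ.commutes]
    · change h (algebraMap K[X] C Polynomial.X) = _
      rw [IsScalarTower.algebraMap_apply K[X] B C, hhB, hψ]
    · intro δ hδ
      rcases List.mem_cons.mp hδ with rfl | hδ
      · refine ⟨⟨j, fun r => ?_⟩, ?_⟩
        · change j (algebraMap K A r) = _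
          rw [IsScalarTower.algebraMap_apply K K[X] A, hjp, IsScalarTower.algebraMap_apply K B C]
          simp [φ]
        · change j (algebraMap K[X] A Polynomial.X) = _
          rw [hjp, IsScalarTower.algebraMap_apply K[X] B C]
          simp [φ, p]
      · obtain ⟨i, hi⟩ := hB δ hδ
        refine ⟨(IsScalarTower.toAlgHom K B C).comp i, ?_⟩
        rw [AlgHom.comp_apply, hi, IsScalarTower.algebraMap_apply K[X] B C]
        rfl

/-! ### Counting coordinate values outside a proper subfield. -/

section RationalValues

variable {K A : Type u} [Field K] [CommRing A] [Algebra K A] [Algebra K[X] A]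
  [IsScalarTower K K[X] A] [Algebra.Etale K[X] A]

theorem IsAmpleField.exists_forall_add_mul_mem (hK : IsAmpleField K) (χ : A →ₐ[K] K) (l : List K) :
    ∃ s : K, s ≠ 0 ∧ ∀ γ ∈ l, ∃ g : A →ₐ[K] K, g (algebraMap K[X] A Polynomial.X) =
      χ (algebraMap K[X] A Polynomial.X) + γ * s := by
  obtain ⟨B, _, _, _, _, _, ψ, hψ, hB⟩ := Algebra.Etale.exists_common_pullback χ l
  obtain ⟨g, hg⟩ := hK.exists_algHom_ne_zero ψ hψ
  refine ⟨_, hg, fun γ hγ => ?_⟩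
  obtain ⟨j, hj⟩ := hB γ hγ
  refine ⟨g.comp j, ?_⟩
  rw [AlgHom.comp_apply, hj]
  have hC (c : K) : g (algebraMap K[X] B (Polynomial.C c)) = c := by
    rw [← Polynomial.algebraMap_eq, ← IsScalarTower.algebraMap_apply, g.commutes]
    rfl
  simp [hC]

/-- The geometric progression `1, α, α ^ 2` with `α` outside a subfield cannot be mapped into the
subfield by a nonconstant affine map. -/
theorem Subfield.exists_add_pow_mul_notMem {K : Type*} [Field K] (K₁ : Subfield K) {α : K}
    (hα : α ∉ K₁) (a : K) {s : K} (hs : s ≠ 0) : ∃ i : Fin 3, a + α ^ (i : ℕ) * s ∉ K₁ := by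
  by_contra! h
  have h0 := h 0
  have h1 := h 1
  have h2 := h 2
  simp only [Fin.val_zero, Fin.val_one, Fin.val_two, pow_zero, pow_one] at h0 h1 h2
  have hα1 : α - 1 ≠ 0 := fun h => hα (by rw [sub_eq_zero.mp h]; exact K₁.one_mem)
  refine hα ?_
  -- The ratio of consecutive differences of the progression is `α`.
  have := K₁.div_mem (K₁.sub_mem h2 h1) (K₁.sub_mem h1 h0)
  convert this using 1
  have h3 : a + α * s - (a + 1 * s) = (α - 1) * s := by ring
  rw [h3, eq_div_iff (mul_ne_zero hα1 hs)]
  ring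

theorem IsAmpleField.mk_rationalValues_diff (hK : IsAmpleField K) [Infinite K] (χ : A →ₐ[K] K)
    (K₁ : Subfield K) (hK₁ : K₁ ≠ ⊤) :
    Cardinal.mk ↥(Set.range (fun g : A →ₐ[K] K => g (algebraMap K[X] A Polynomial.X)) \
      (K₁ : Set K)) = Cardinal.mk K := by
  set D := Set.range (fun g : A →ₐ[K] K => g (algebraMap K[X] A Polynomial.X)) \ (K₁ : Set K)
  obtain ⟨α, hα⟩ : ∃ α, α ∉ K₁ := by
    by_contra! h
    exact hK₁ (eq_top_iff.mpr fun x _ => h x)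
  have hα0 : α ≠ 0 := fun h => hα (h ▸ K₁.zero_mem)
  set a := χ (algebraMap K[X] A Polynomial.X)
  -- From `a + α^i s` and `a + α^j β s` this recovers `β`; `none` accounts for `β = 0`.
  let F : Option ((D × D) × (Fin 3 × Fin 3)) → K := fun o =>
    o.elim 0 fun t => (t.1.2 - a) / (t.1.1 - a) * (α ^ (t.2.1 : ℕ) / α ^ (t.2.2 : ℕ))
  have hF : Function.Surjective F := by
    intro β
    rcases eq_or_ne β 0 with rfl | hβ
    · exact ⟨none, rfl⟩
    obtain ⟨s, hs, hl⟩ := hK.exists_forall_add_mul_mem χ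
      ((List.ofFn fun i : Fin 3 => α ^ (i : ℕ)) ++ List.ofFn fun i : Fin 3 => α ^ (i : ℕ) * β)
    obtain ⟨i, hi⟩ := K₁.exists_add_pow_mul_notMem hα a hs
    obtain ⟨j, hj⟩ := K₁.exists_add_pow_mul_notMem hα a (mul_ne_zero hβ hs)
    rw [← mul_assoc] at hj
    have mem_i := hl (α ^ (i : ℕ)) (by simp only [List.mem_append, List.mem_ofFn]; exact .inl ⟨i, rfl⟩)
    have mem_j := hl (α ^ (j : ℕ) * β)
      (by simp only [List.mem_append, List.mem_ofFn]; exact .inr ⟨j, rfl⟩)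
    refine ⟨some ((⟨_, mem_i, hi⟩, ⟨_, mem_j, hj⟩), (i, j)), ?_⟩
    have hi0 := pow_ne_zero (i : ℕ) hα0
    have hj0 := pow_ne_zero (j : ℕ) hα0
    change (a + α ^ (j : ℕ) * β * s - a) / (a + α ^ (i : ℕ) * s - a) *
      (α ^ (i : ℕ) / α ^ (j : ℕ)) = β
    rw [add_sub_cancel_left, add_sub_cancel_left]
    field_simp
  have hD : Infinite D := by
    by_contra h
    rw [not_infinite_iff_finite] at h
    have := Finite.of_surjective F hF
    exact not_finite K
  refine le_antisymm (Cardinal.mk_set_le D) ?_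
  calc Cardinal.mk K ≤ Cardinal.mk (Option ((D × D) × (Fin 3 × Fin 3))) :=
        Cardinal.mk_le_of_surjective hF
    _ = Cardinal.mk D := by
        have h := Cardinal.aleph0_le_mk D
        rw [Cardinal.mk_option, Cardinal.mk_prod,
          ← Cardinal.mul_def,
          Cardinal.mul_eq_self h, Cardinal.lift_uzero, Cardinal.mul_eq_left h,
          Cardinal.add_one_eq h]
        · exact (Cardinal.lift_lt_aleph0.mpr Cardinal.mk_lt_aleph0).le.trans h
        · simp

end RationalValues

/-! ### Existential sets as images of rational points. -/

/-- A relation `S` on `K × Kⁿ` is an affine image if there are an affine `K`-scheme of finite type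
and a tuple of functions on it such that `S` consists of the values of the tuple at the
`K`-rational points. -/
def IsAffineImage {K : Type u} [Field K] {n : ℕ} (S : K → (Fin n → K) → Prop) : Prop :=
  ∃ (D : Type u) (_ : CommRing D) (_ : Algebra K D) (x : D) (y : Fin n → D),
    Algebra.FiniteType K D ∧
      ∀ a b, S a b ↔ ∃ f : D →ₐ[K] K, f x = a ∧ ∀ i, f (y i) = b i

namespace IsAffineImage

variable {K : Type u} [Field K] {n : ℕ} {S T : K → (Fin n → K) → Prop}

theorem congr (hS : IsAffineImage S) (h : ∀ a b, S a b ↔ T a b) : IsAffineImage T := by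
  have : S = T := by ext; apply h
  exact this ▸ hS

theorem false : IsAffineImage fun (_ : K) (_ : Fin n → K) => False := by
  refine ⟨PUnit, inferInstance, inferInstance, 0, 0, inferInstance, fun a b => ?_⟩
  refine ⟨False.elim, fun ⟨f, _⟩ => ?_⟩
  exact one_ne_zero ((map_one f).symm.trans (map_zero f))

theorem exists_algHom_mvPolynomial (a : K) (b : Fin n → K)
    (P : (MvPolynomial (Option (Fin n)) K →ₐ[K] K) → Prop) :
    (∃ f, P f ∧ f (.X none) = a ∧ ∀ i, f (.X (some i)) = b i) ↔
      P (MvPolynomial.aeval fun o => o.elim a b) := by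
  constructor
  · rintro ⟨f, hf, ha, hb⟩
    convert hf
    refine MvPolynomial.algHom_ext fun i => ?_
    cases i <;> simp [ha, hb]
  · intro h
    exact ⟨_, h, by simp, by simp⟩

theorem eq_zero (p : MvPolynomial (Option (Fin n)) K) :
    IsAffineImage fun (a : K) (b : Fin n → K) => MvPolynomial.aeval (fun o => o.elim a b) p = 0 := by
  refine ⟨MvPolynomial (Option (Fin n)) K ⧸ Ideal.span {p}, inferInstance, inferInstance,
    Ideal.Quotient.mk _ (.X none), fun i => Ideal.Quotient.mk _ (.X (some i)), inferInstance,
    fun a b => ?_⟩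
  refine (exists_algHom_mvPolynomial a b (fun f => f p = 0)).symm.trans ?_
  constructor
  · rintro ⟨f, hp, ha, hb⟩
    refine ⟨Ideal.Quotient.liftₐ _ f fun q hq => ?_, ha, hb⟩
    have : Ideal.span {p} ≤ RingHom.ker f := by
      rwa [Ideal.span_singleton_le_iff_mem]
    exact this hq
  · rintro ⟨f, ha, hb⟩
    refine ⟨f.comp (Ideal.Quotient.mkₐ K _), ?_, ha, hb⟩
    have : Ideal.Quotient.mk (Ideal.span {p}) p = 0 :=
      Ideal.Quotient.eq_zero_iff_mem.mpr (Ideal.mem_span_singleton_self p)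
    simp [this]

theorem ne_zero (p : MvPolynomial (Option (Fin n)) K) :
    IsAffineImage fun (a : K) (b : Fin n → K) => MvPolynomial.aeval (fun o => o.elim a b) p ≠ 0 := by
  refine ⟨Localization.Away p, inferInstance, inferInstance,
    algebraMap (MvPolynomial (Option (Fin n)) K) _ (.X none),
    fun i => algebraMap (MvPolynomial (Option (Fin n)) K) _ (.X (some i)),
    .trans (S := MvPolynomial (Option (Fin n)) K) inferInstance
      (IsLocalization.finiteType_of_monoid_fg (Submonoid.powers p) _),
    fun a b => ?_⟩
  refine (exists_algHom_mvPolynomial a b (fun f => f p ≠ 0)).symm.trans ?_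
  constructor
  · rintro ⟨f, hp, ha, hb⟩
    refine ⟨IsLocalization.liftAlgHom (M := Submonoid.powers p) (f := f) ?_, ?_, ?_⟩
    · rintro ⟨_, n, rfl⟩
      simpa using (isUnit_iff_ne_zero.mpr hp).pow n
    · simpa using ha
    · simpa using hb
  · rintro ⟨f, ha, hb⟩
    refine ⟨f.comp (IsScalarTower.toAlgHom K _ _), ?_, ha, hb⟩
    exact ((IsLocalization.Away.algebraMap_isUnit (S := Localization.Away p) p).map f).ne_zero

theorem and (hS : IsAffineImage S) (hT : IsAffineImage T) :
    IsAffineImage fun a b => S a b ∧ T a b := by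
  obtain ⟨D, _, _, x, y, _, hD⟩ := hS
  obtain ⟨E, _, _, z, w, _, hE⟩ := hT
  let I : Ideal (D ⊗[K] E) :=
    .span (insert (x ⊗ₜ 1 - 1 ⊗ₜ z) (Set.range fun i => y i ⊗ₜ 1 - 1 ⊗ₜ w i))
  have hx : Ideal.Quotient.mk I (x ⊗ₜ 1) = Ideal.Quotient.mk I (1 ⊗ₜ z) :=
    Ideal.Quotient.eq.mpr (Ideal.subset_span (.inl rfl))
  have hy (i) : Ideal.Quotient.mk I (y i ⊗ₜ 1) = Ideal.Quotient.mk I (1 ⊗ₜ w i) :=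
    Ideal.Quotient.eq.mpr (Ideal.subset_span (.inr ⟨i, rfl⟩))
  have : Algebra.FiniteType K (D ⊗[K] E) := .trans (S := D) inferInstance inferInstance
  refine ⟨(D ⊗[K] E) ⧸ I, inferInstance, inferInstance, Ideal.Quotient.mk I (x ⊗ₜ 1),
    fun i => Ideal.Quotient.mk I (y i ⊗ₜ 1), inferInstance, fun a b => ?_⟩
  refine (and_congr (hD a b) (hE a b)).trans ?_
  constructor
  · rintro ⟨⟨f, hfa, hfb⟩, ⟨g, hga, hgb⟩⟩
    let h := Algebra.TensorProduct.lift f g fun _ _ => Commute.all _ _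
    have hI : I ≤ RingHom.ker h := by
      rw [Ideal.span_le]
      rintro _ (rfl | ⟨i, rfl⟩) <;> simp [h, RingHom.mem_ker, hfa, hga, hfb, hgb]
    refine ⟨Ideal.Quotient.liftₐ I h hI, ?_, fun i => ?_⟩
    · change h (x ⊗ₜ 1) = a
      simp [h, hfa]
    · change h (y i ⊗ₜ 1) = b i
      simp [h, hfb]
  · rintro ⟨f, hfa, hfb⟩
    exact ⟨⟨(f.comp (Ideal.Quotient.mkₐ K I)).comp Algebra.TensorProduct.includeLeft, hfa, hfb⟩,
      ⟨(f.comp (Ideal.Quotient.mkₐ K I)).comp Algebra.TensorProduct.includeRight,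
        (congrArg f hx).symm.trans hfa, fun i => (congrArg f (hy i)).symm.trans (hfb i)⟩⟩

/-- The product algebra is the disjoint union: a `K`-point kills one of the two complementary
idempotents. -/
theorem or (hS : IsAffineImage S) (hT : IsAffineImage T) :
    IsAffineImage fun a b => S a b ∨ T a b := by
  obtain ⟨D, _, _, x, y, _, hD⟩ := hS
  obtain ⟨E, _, _, z, w, _, hE⟩ := hT
  refine ⟨D × E, inferInstance, inferInstance, (x, z), fun i => (y i, w i), ?_, fun a b => ?_⟩
  · infer_instance
  refine (or_congr (hD a b) (hE a b)).trans ?_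
  constructor
  · rintro (⟨f, hfa, hfb⟩ | ⟨f, hfa, hfb⟩)
    · exact ⟨f.comp (AlgHom.fst K D E), hfa, hfb⟩
    · exact ⟨f.comp (AlgHom.snd K D E), hfa, hfb⟩
  · rintro ⟨f, hfa, hfb⟩
    have hsum : f (1, 0) + f (0, 1) = 1 := by
      rw [← map_add, Prod.mk_add_mk, add_zero, zero_add]
      exact map_one f
    have hmul : f (1, 0) * f (0, 1) = 0 := by
      rw [← map_mul, Prod.mk_mul_mk, mul_zero, zero_mul]
      exact map_zero f
    rcases mul_eq_zero.mp hmul with h | h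
    · right
      have h1 : f (0, 1) = 1 := by simpa [h] using hsum
      have key (d : D) (e : E) : f (d, e) = f (0, e) := by
        have : f ((d, e) * (0, 1)) = f (d, e) * f (0, 1) := map_mul _ _ _
        simpa [h1] using this.symm
      refine ⟨AlgHom.ofLinearMap (f.toLinearMap.comp (LinearMap.inr K D E)) h1 fun d e => ?_, ?_, ?_⟩
      · simp [← map_mul]
      · exact (key x z).symm.trans hfa
      · exact fun i => (key (y i) (w i)).symm.trans (hfb i)
    · left
      have h1 : f (1, 0) = 1 := by simpa [h] using hsum
      have key (d : D) (e : E) : f (d, e) = f (d, 0) := by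
        have : f ((d, e) * (1, 0)) = f (d, e) * f (1, 0) := map_mul _ _ _
        simpa [h1] using this.symm
      refine ⟨AlgHom.ofLinearMap (f.toLinearMap.comp (LinearMap.inl K D E)) h1 fun d e => ?_, ?_, ?_⟩
      · simp [← map_mul]
      · exact (key x z).symm.trans hfa
      · exact fun i => (key (y i) (w i)).symm.trans (hfb i)

/-- Projection keeps the algebra and forgets the last function. -/
theorem exists_snoc {S : K → (Fin (n + 1) → K) → Prop} (hS : IsAffineImage S) :
    IsAffineImage fun a b => ∃ c, S a (Fin.snoc b c) := by
  obtain ⟨D, _, _, x, y, hfin, hD⟩ := hS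
  refine ⟨D, inferInstance, inferInstance, x, fun i => y i.castSucc, hfin, fun a b => ?_⟩
  simp only [hD]
  constructor
  · rintro ⟨c, f, hfa, hfb⟩
    exact ⟨f, hfa, fun i => by simpa using hfb i.castSucc⟩
  · rintro ⟨f, hfa, hfb⟩
    refine ⟨f (y (Fin.last n)), f, hfa, fun i => ?_⟩
    induction i using Fin.lastCases with
    | last => simp
    | cast i => simpa using hfb i

end IsAffineImage

section Formulas

open FirstOrder FirstOrder.Language

variable {K : Type u} [Field K] [FirstOrder.Ring.CompatibleRing K] {A : Set K} {n : ℕ}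

theorem FirstOrder.Ring.exists_mvPolynomial_aeval_eq_realize
    (t : Language.ring.Term ((A ⊕ Unit) ⊕ Fin n)) :
    ∃ p : MvPolynomial (Option (Fin n)) K, ∀ a b,
      t.realize (Sum.elim (Sum.elim (fun c : A => (c : K)) fun _ => a) b) =
        MvPolynomial.aeval (fun o => o.elim a b) p := by
  induction t with
  | var v =>
    rcases v with (c | _) | i
    · exact ⟨.C c, by simp⟩
    · exact ⟨.X none, by simp⟩
    · exact ⟨.X (some i), by simp⟩
  | func f ts ih =>
    choose p hp using ih
    cases f with
    | add =>
      exact ⟨p 0 + p 1, fun a b =>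
        (FirstOrder.Ring.CompatibleRing.funMap_add _).trans (by simp [hp])⟩
    | mul =>
      exact ⟨p 0 * p 1, fun a b =>
        (FirstOrder.Ring.CompatibleRing.funMap_mul _).trans (by simp [hp])⟩
    | neg =>
      exact ⟨-p 0, fun a b =>
        (FirstOrder.Ring.CompatibleRing.funMap_neg _).trans (by simp [hp])⟩
    | zero =>
      exact ⟨0, fun a b =>
        (FirstOrder.Ring.CompatibleRing.funMap_zero _).trans (by simp)⟩
    | one =>
      exact ⟨1, fun a b =>
        (FirstOrder.Ring.CompatibleRing.funMap_one _).trans (by simp)⟩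

/-- The negation is carried along so that the induction passes through implications. -/
theorem FirstOrder.Language.BoundedFormula.IsQF.isAffineImage
    {φ : Language.ring.BoundedFormula (A ⊕ Unit) n} (hφ : φ.IsQF) :
    IsAffineImage (fun a b => φ.Realize (Sum.elim (fun c : A => (c : K)) fun _ => a) b) ∧
    IsAffineImage (fun a b => ¬ φ.Realize (Sum.elim (fun c : A => (c : K)) fun _ => a) b) := by
  induction hφ with
  | falsum =>
    refine ⟨IsAffineImage.false, (IsAffineImage.eq_zero 0).congr fun a b => ?_⟩
    simp [BoundedFormula.Realize]
  | of_isAtomic h =>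
    cases h with
    | equal t s =>
      obtain ⟨p, hp⟩ := FirstOrder.Ring.exists_mvPolynomial_aeval_eq_realize t
      obtain ⟨q, hq⟩ := FirstOrder.Ring.exists_mvPolynomial_aeval_eq_realize s
      refine ⟨(IsAffineImage.eq_zero (p - q)).congr fun a b => ?_,
        (IsAffineImage.ne_zero (p - q)).congr fun a b => ?_⟩ <;>
      simp [BoundedFormula.realize_bdEqual, hp, hq, sub_eq_zero]
    | rel R => exact isEmptyElim R
  | imp _ _ h₁ h₂ =>
    refine ⟨(h₁.2.or h₂.1).congr fun a b => ?_, (h₁.1.and h₂.2).congr fun a b => ?_⟩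
    · rw [BoundedFormula.realize_imp, imp_iff_not_or]
    · rw [BoundedFormula.realize_imp, Classical.not_imp]

theorem FirstOrder.Language.BoundedFormula.IsExistential.isAffineImage
    {φ : Language.ring.BoundedFormula (A ⊕ Unit) n} (hφ : φ.IsExistential) :
    IsAffineImage fun a b => φ.Realize (Sum.elim (fun c : A => (c : K)) fun _ => a) b := by
  induction hφ with
  | of_isQF h => exact h.isAffineImage.1
  | ex _ ih => exact ih.exists_snoc.congr fun a b => BoundedFormula.realize_ex.symm

theorem IsExistentiallyDefinable.exists_algebra {X : Set K}
    (hX : IsExistentiallyDefinable Language.ring A X) :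
    ∃ (D : Type u) (_ : CommRing D) (_ : Algebra K D) (x : D),
      Algebra.FiniteType K D ∧ X = Set.range fun f : D →ₐ[K] K => f x := by
  obtain ⟨φ, hφ, rfl⟩ := hX
  obtain ⟨D, _, _, x, y, hfin, hD⟩ := hφ.isAffineImage
  refine ⟨D, inferInstance, inferInstance, x, hfin, ?_⟩
  ext a
  refine (hD a default).trans ?_
  simp

end Formulas

/-! ### An extension field in which `K` is existentially closed. -/

section FunctionsModuloMaximalIdeal

variable {K X : Type*} [Field K] (M : Ideal (X → K))

/-- Finitely many functions without a common zero generate the unit ideal: at each `s`, divide by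
one that is nonzero there. -/
theorem Ideal.IsMaximal.exists_forall_apply_eq_zero (hM : M.IsMaximal) (F : Finset (X → K))
    (hF : ∀ f ∈ F, f ∈ M) : ∃ s, ∀ f ∈ F, f s = 0 := by
  classical
  by_contra! h
  choose j hj hj0 using h
  refine hM.ne_top ((Ideal.eq_top_iff_one _).mpr ?_)
  have : (1 : X → K) = ∑ f ∈ F, (fun s => if j s = f then (f s)⁻¹ else 0) * f := by
    ext s
    simp only [Pi.one_apply, Finset.sum_apply, Pi.mul_apply, ite_mul, zero_mul]
    rw [Finset.sum_ite_eq, if_pos (hj s), inv_mul_cancel₀ (hj0 s)]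
  rw [this]
  exact Ideal.sum_mem _ fun f hf => Ideal.mul_mem_left _ _ (hF f hf)

/-- Lift the images of the generators to functions. The finitely many relations of `C` then take
values in `M`, so all of them hold at a single index. -/
theorem Ideal.IsMaximal.nonempty_algHom_of_algHom_quotient (hM : M.IsMaximal) {C : Type*}
    [CommRing C] [Algebra K C] [Algebra.FiniteType K C] (f : C →ₐ[K] (X → K) ⧸ M) :
    Nonempty (C →ₐ[K] K) := by
  classical
  have : Algebra.FinitePresentation K C := Algebra.FinitePresentation.of_finiteType.mp inferInstance
  obtain ⟨n, π, hπ, hker⟩ := Algebra.FinitePresentation.out (R := K) (A := C)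
  obtain ⟨G, hG⟩ := hker
  choose η hη using fun i : Fin n => Ideal.Quotient.mk_surjective (f (π (.X i)))
  let e : MvPolynomial (Fin n) K →ₐ[K] (X → K) := MvPolynomial.aeval η
  have he : (Ideal.Quotient.mkₐ K M).comp e = f.comp π :=
    MvPolynomial.algHom_ext fun i => by simp [e, hη]
  obtain ⟨s, hs⟩ := hM.exists_forall_apply_eq_zero M (G.image e) (by
    simp only [Finset.mem_image, forall_exists_index, and_imp, forall_apply_eq_imp_iff₂]
    intro p hp
    have hp0 : π p = 0 := by
      have : p ∈ RingHom.ker π := hG ▸ Ideal.subset_span hp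
      exact this
    have := congrArg (fun t => t p) he
    simp only [AlgHom.comp_apply, hp0, map_zero] at this
    exact Ideal.Quotient.eq_zero_iff_mem.mp this)
  let g : MvPolynomial (Fin n) K →ₐ[K] K := (Pi.evalAlgHom K (fun _ : X => K) s).comp e
  have hg : RingHom.ker π ≤ RingHom.ker g := by
    refine hG.symm.le.trans (Ideal.span_le.mpr fun p hp => ?_)
    exact hs _ (Finset.mem_image_of_mem e hp)
  exact ⟨(Ideal.Quotient.liftₐ (RingHom.ker π) g hg).comp
    (Ideal.quotientKerAlgEquivOfSurjective hπ).symm.toAlgHom⟩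

theorem Ideal.exists_isMaximal_forall_finite_support_mem [Infinite X] :
    ∃ M : Ideal (X → K), M.IsMaximal ∧ ∀ f : X → K, f.support.Finite → f ∈ M := by
  let J : Ideal (X → K) :=
    { carrier := {f | f.support.Finite}
      zero_mem' := by simp
      add_mem' := fun {f g} hf hg => (hf.union hg).subset (Function.support_add f g)
      smul_mem' := fun c f hf => hf.subset (Function.support_mul_subset_right c f) }
  have hJ : J ≠ ⊤ := by
    rw [Ideal.ne_top_iff_one]
    intro h
    have h1 : (Function.support (1 : X → K)).Finite := h
    rw [Function.support_one] at h1
    exact Set.infinite_univ h1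
  obtain ⟨M, hM, hJM⟩ := Ideal.exists_le_maximal J hJ
  exact ⟨M, hM, fun f hf => hJM hf⟩

end FunctionsModuloMaximalIdeal

/-- An element of a finitely generated algebra that takes infinitely many values at rational points
becomes transcendental under a homomorphism to a perfect extension field in which the base field is
existentially closed. -/
theorem Algebra.FiniteType.exists_transcendental_of_infinite_range {K D : Type u} [Field K]
    [PerfectField K] [CommRing D] [Algebra K D] (x : D)
    (hx : (Set.range fun f : D →ₐ[K] K => f x).Infinite) :
    ∃ (Ω : Type u) (_ : Field Ω) (_ : Algebra K Ω) (i : D →ₐ[K] Ω), PerfectField Ω ∧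
      Transcendental K (i x) ∧ ∀ (C : Type u) [CommRing C] [Algebra K C] [Algebra.FiniteType K C],
        (C →ₐ[K] Ω) → Nonempty (C →ₐ[K] K) := by
  classical
  let X := ↥(Set.range fun f : D →ₐ[K] K => f x)
  have : Infinite X := hx.to_subtype
  obtain ⟨M, hM, hfin⟩ := Ideal.exists_isMaximal_forall_finite_support_mem (K := K) (X := X)
  let := Ideal.Quotient.field M
  choose ev hev using fun s : X => s.2
  let i : D →ₐ[K] (X → K) ⧸ M := (Ideal.Quotient.mkₐ K M).comp (AlgHom.pi ev)
  refine ⟨(X → K) ⧸ M, inferInstance, inferInstance, i, ?_, ?_,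
    fun C _ _ _ f => hM.nonempty_algHom_of_algHom_quotient M f⟩
  · obtain ⟨p, hp⟩ := ExpChar.exists K
    have := expChar_of_injective_algebraMap (algebraMap K ((X → K) ⧸ M)).injective p
    have : PerfectRing ((X → K) ⧸ M) p := by
      refine PerfectRing.ofSurjective _ _ fun z => ?_
      obtain ⟨f, rfl⟩ := Ideal.Quotient.mk_surjective z
      choose g hg using fun s => surjective_frobenius K p (f s)
      refine ⟨Ideal.Quotient.mk M g, ?_⟩
      rw [frobenius_def, ← map_pow]
      congr 1
      ext s
      exact hg s
    exact PerfectRing.toPerfectField _ p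
  · rw [transcendental_iff]
    intro h hh
    by_contra h0
    let f : X → K := fun s => h.eval (s : K)
    have hf : f ∈ M := by
      rw [← Ideal.Quotient.eq_zero_iff_mem, ← hh]
      have : f = Polynomial.aeval (AlgHom.pi ev x) h := by
        ext s
        change h.eval (s : K) = Pi.evalAlgHom K (fun _ : X => K) s (Polynomial.aeval _ h)
        rw [← Polynomial.aeval_algHom_apply, ← Polynomial.coe_aeval_eq_eval]
        congr 2
        exact (hev s).symm
      rw [this]
      change Ideal.Quotient.mkₐ K M _ = _
      rw [← Polynomial.aeval_algHom_apply]
      rfl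
    -- The indicator of the finitely many roots of `h` in `X` lies in `M`, yet `f + g` vanishes
    -- nowhere and is a unit.
    let g : X → K := fun s => if f s = 0 then 1 else 0
    have hg : g ∈ M := by
      refine hfin g ?_
      have : (Subtype.val '' {s : X | f s = 0}).Finite :=
        (h.rootSet_finite K).subset (by
          rintro _ ⟨s, hs, rfl⟩
          rw [Polynomial.mem_rootSet]
          exact ⟨h0, by rw [Polynomial.coe_aeval_eq_eval]; exact hs⟩)
      refine (this.of_finite_image Subtype.val_injective.injOn).subset fun s hs => ?_
      by_contra hs'
      exact hs (if_neg hs')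
    have hunit : IsUnit (f + g) := by
      rw [Pi.isUnit_iff]
      intro s
      rw [isUnit_iff_ne_zero]
      by_cases hs : f s = 0 <;> simp [g, hs]
    exact hM.ne_top (M.eq_top_of_isUnit_mem (M.add_mem hf hg) hunit)

/-! ### Descent of étale algebras to a finitely generated base. -/

/-- An étale algebra over a field `E`, together with a finitely generated subalgebra, is already
defined over any localization of a subring `P` of `E` that contains finitely many prescribed
elements. -/
theorem Algebra.Etale.exists_finset_descent {K E F D : Type u} [Field K] [Field E] [CommRing F]
    [CommRing D] [Algebra K E] [Algebra E F] [Algebra K F] [IsScalarTower K E F]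
    [Algebra.Etale E F] [Algebra K D] [Algebra.FiniteType K D] (i : D →ₐ[K] F) :
    ∃ Z : Finset E, ∀ (P : Type u) [CommRing P] [Algebra K P] (φ : P →ₐ[K] E),
      Function.Injective φ → ∀ q : P, φ q ≠ 0 → (∀ z ∈ Z, ∃ a, z * φ q = φ a) →
      ∃ (B : Type u) (_ : CommRing B) (_ : Algebra K B) (_ : Algebra P B)
        (_ : IsScalarTower K P B) (ι : B →ₐ[K] F) (j : D →ₐ[K] B), Algebra.Etale P B ∧
        Function.Injective ι ∧ ι.comp j = i ∧
        ∀ p, ι (algebraMap P B p) = algebraMap E F (φ p) := by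
  classical
  obtain ⟨A₀, B₀, _, _, ⟨Z₀, hZ₀⟩, _, ⟨e⟩⟩ := Algebra.Etale.exists_subalgebra_fg K E F
  obtain ⟨S, hS⟩ := Algebra.FiniteType.out (R := K) (A := D)
  choose c hc using fun d : D => TensorProduct.exists_finset (e (i d))
  -- Generators of the subring `A₀` over which `F` is defined, and the `E`-coefficients of the
  -- images of the generators of `D`.
  refine ⟨Z₀ ∪ S.biUnion fun d => (c d).image Prod.fst, ?_⟩
  intro P _ _ φ hφ q hq hZ
  obtain ⟨L, _, _, _, _, _⟩ : ∃ (L : Type u) (_ : CommRing L) (_ : Algebra K L) (_ : Algebra P L),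
      IsScalarTower K P L ∧ IsLocalization.Away q L :=
    ⟨Localization.Away q, inferInstance, inferInstance, inferInstance, inferInstance, inferInstance⟩
  let φ' : L →ₐ[K] E :=
    IsLocalization.liftAlgHom (M := Submonoid.powers q) (f := φ) (by
      rintro ⟨_, n, rfl⟩
      simpa using (isUnit_iff_ne_zero.mpr hq).pow n)
  have hφ'P (p : P) : φ' (algebraMap P _ p) = φ p := by simp [φ']
  have hφ' : Function.Injective φ' := by
    rw [injective_iff_map_eq_zero]
    intro z hz
    obtain ⟨b, s, rfl⟩ := IsLocalization.exists_mk'_eq (Submonoid.powers q) z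
    have := congrArg φ' (IsLocalization.mk'_spec L b s)
    rw [map_mul, hz, zero_mul, hφ'P] at this
    rw [(injective_iff_map_eq_zero _).mp hφ b this.symm, IsLocalization.mk'_zero]
  have hrange : ∀ z ∈ Z₀ ∪ S.biUnion fun d => (c d).image Prod.fst, z ∈ φ'.range := by
    intro z hz
    obtain ⟨a, ha⟩ := hZ z hz
    refine ⟨IsLocalization.mk' _ a (⟨q, Submonoid.mem_powers q⟩ : Submonoid.powers q), ?_⟩
    have := congrArg φ' (IsLocalization.mk'_spec L a
      ⟨q, Submonoid.mem_powers q⟩)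
    rw [map_mul, hφ'P, hφ'P, ← ha] at this
    exact mul_right_cancel₀ hq this
  have hA₀ : A₀ ≤ φ'.range := by
    rw [← hZ₀]
    exact Algebra.adjoin_le fun z hz => hrange z (Finset.mem_union_left _ hz)
  let u : A₀ →ₐ[K] L :=
    (AlgEquiv.ofInjective φ' hφ').symm.toAlgHom.comp (Subalgebra.inclusion hA₀)
  have hu (a : A₀) : φ' (u a) = a := by
    have := (AlgEquiv.ofInjective φ' hφ').apply_symm_apply (Subalgebra.inclusion hA₀ a)
    exact congrArg Subtype.val this
  let := u.toRingHom.toAlgebra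
  have : IsScalarTower K A₀ L := .of_algebraMap_eq fun r => (u.commutes r).symm
  let φA : L →ₐ[A₀] E := ⟨φ'.toRingHom, hu⟩
  let B := L ⊗[A₀] B₀
  let ι₀ : B →ₐ[A₀] E ⊗[A₀] B₀ := Algebra.TensorProduct.map φA (AlgHom.id A₀ B₀)
  -- `B₀` is étale, hence flat, over `A₀`.
  have hι₀ : Function.Injective ι₀ := by
    exact Module.Flat.rTensor_preserves_injective_linearMap (M := B₀) φA.toLinearMap hφ'
  let ι₁ : B →+* F := e.symm.toRingHom.comp ι₀.toRingHom
  have hι₁ : Function.Injective ι₁ := e.symm.injective.comp hι₀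
  have hι₁L (l : L) : ι₁ (l ⊗ₜ 1) = algebraMap E F (φ' l) := by
    change e.symm (ι₀ (l ⊗ₜ 1)) = _
    have : ι₀ (l ⊗ₜ 1) = algebraMap E (E ⊗[A₀] B₀) (φ' l) := by
      exact Algebra.TensorProduct.map_tmul _ _ _ _
    rw [this, e.symm.commutes]
  have : IsScalarTower P L B := inferInstance
  have : IsScalarTower K P B := .to₁₂₄ K P L B
  have : Algebra.Etale P L := .of_isLocalizationAway q
  have : Algebra.Etale P B := .comp P L B
  have hιP (p : P) : ι₁ (algebraMap P B p) = algebraMap E F (φ p) := by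
    rw [← hφ'P, ← hι₁L]
    rfl
  let ι : B →ₐ[K] F := ⟨ι₁, fun r => by
    change ι₁ (algebraMap K B r) = _
    rw [IsScalarTower.algebraMap_apply K P B, hιP, φ.commutes, ← IsScalarTower.algebraMap_apply]⟩
  have hi : i.range ≤ ι.range := by
    rw [← Algebra.map_top, ← hS, AlgHom.map_adjoin]
    refine Algebra.adjoin_le ?_
    rintro _ ⟨d, hd, rfl⟩
    have key : e (i d) ∈ ι₀.range := by
      rw [hc]
      refine Subalgebra.sum_mem _ fun t ht => ?_
      obtain ⟨l, hl⟩ := hrange t.1 (Finset.mem_union_right _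
        (Finset.mem_biUnion.mpr ⟨d, hd, Finset.mem_image_of_mem _ ht⟩))
      refine ⟨l ⊗ₜ t.2, ?_⟩
      change φ' l ⊗ₜ t.2 = _
      rw [show φ' l = t.1 from hl]
    obtain ⟨b, hb⟩ := key
    refine ⟨b, ?_⟩
    change e.symm (ι₀ b) = i d
    rw [show ι₀ b = e (i d) from hb, e.symm_apply_apply]
  let j : D →ₐ[K] B := (AlgEquiv.ofInjective ι hι₁).symm.toAlgHom.comp
    ((Subalgebra.inclusion hi).comp i.rangeRestrict)
  refine ⟨B, inferInstance, inferInstance, inferInstance, inferInstance, ι, j, inferInstance,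
    hι₁, ?_, hιP⟩
  ext d
  have := (AlgEquiv.ofInjective ι hι₁).apply_symm_apply
    (Subalgebra.inclusion hi (i.rangeRestrict d))
  exact congrArg Subtype.val this

/-! ### Replacing the perfect closure of `K(x)` by a single root of `x`. -/

section PerfectClosureOfSimpleExtension

open IntermediateField

variable {K Ω : Type*} [Field K] [Field Ω] [Algebra K Ω] (p : ℕ) [ExpChar K p]

/-- As `K` is perfect, every element of `K(x)` is a `p ^ k`-th power from `K(w)`, and such roots are
unique. -/
theorem IntermediateField.mem_adjoin_root_of_pow_mem_adjoin [PerfectField K] {k : ℕ} {x w z : Ω}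
    (hw : w ^ p ^ k = x) (hz : z ^ p ^ k ∈ K⟮x⟯) : z ∈ K⟮w⟯ := by
  have := expChar_of_injective_algebraMap (algebraMap K Ω).injective p
  have key : ∀ y ∈ K⟮x⟯, ∃ u ∈ K⟮w⟯, u ^ p ^ k = y := by
    intro y hy
    induction hy using adjoin_induction with
    | mem y hy => exact ⟨w, mem_adjoin_simple_self K w, hw.trans (Set.mem_singleton_iff.mp hy).symm⟩
    | algebraMap c =>
      refine ⟨algebraMap K Ω ((iterateFrobeniusEquiv K p k).symm c), algebraMap_mem _ _, ?_⟩
      rw [← map_pow, ← iterateFrobeniusEquiv_def, RingEquiv.apply_symm_apply]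
    | add y z _ _ ihy ihz =>
      obtain ⟨u, hu, rfl⟩ := ihy
      obtain ⟨v, hv, rfl⟩ := ihz
      exact ⟨u + v, add_mem hu hv, add_pow_expChar_pow ..⟩
    | inv y _ ih =>
      obtain ⟨u, hu, rfl⟩ := ih
      exact ⟨u⁻¹, inv_mem hu, inv_pow ..⟩
    | mul y z _ _ ihy ihz =>
      obtain ⟨u, hu, rfl⟩ := ihy
      obtain ⟨v, hv, rfl⟩ := ihz
      exact ⟨u * v, mul_mem hu hv, mul_pow ..⟩
  obtain ⟨u, hu, huz⟩ := key _ hz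
  have h : u = z := iterateFrobenius_inj Ω p k (by simpa [iterateFrobenius_def] using huz)
  exact h ▸ hu

/-- Only finitely many elements of the perfect closure enter `z`. Allowing all `k ≥ k₀` lets the
bounds for several `z` be merged. -/
theorem IntermediateField.exists_forall_mem_adjoin_root [PerfectField K] {x : Ω} {σ : Type*}
    (F : IntermediateField (perfectClosure K⟮x⟯ Ω) Ω) (t : σ → F) {z : F}
    (hz : z ∈ adjoin (perfectClosure K⟮x⟯ Ω) (Set.range t)) :
    ∃ k₀, ∀ k ≥ k₀, ∀ w : Ω, w ^ p ^ k = x →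
      (z : Ω) ∈ adjoin K (Set.range (Sum.elim (fun i => (t i : Ω)) fun _ : Unit => w)) := by
  have := expChar_of_injective_algebraMap (algebraMap K K⟮x⟯).injective p
  induction hz using adjoin_induction with
  | mem z hz =>
    obtain ⟨i, rfl⟩ := hz
    exact ⟨0, fun k _ w _ => subset_adjoin _ _ ⟨.inl i, rfl⟩⟩
  | algebraMap c =>
    obtain ⟨n, hn⟩ := (mem_perfectClosure_iff_pow_mem p).mp c.2
    refine ⟨n, fun k hk w hw => ?_⟩
    have hc : (c : Ω) ^ p ^ k ∈ K⟮x⟯ := by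
      obtain ⟨m, rfl⟩ := Nat.exists_eq_add_of_le hk
      obtain ⟨y, hy⟩ := hn
      rw [pow_add, pow_mul, ← hy]
      exact pow_mem y.2 _
    exact adjoin.mono K _ _ (Set.singleton_subset_iff.mpr (Set.mem_range.mpr ⟨.inr (), rfl⟩))
      (mem_adjoin_root_of_pow_mem_adjoin p hw hc)
  | add y z _ _ ihy ihz =>
    obtain ⟨k₁, h₁⟩ := ihy
    obtain ⟨k₂, h₂⟩ := ihz
    exact ⟨max k₁ k₂, fun k hk w hw => add_mem (h₁ k (le_of_max_le_left hk) w hw)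
      (h₂ k (le_of_max_le_right hk) w hw)⟩
  | inv y _ ih =>
    obtain ⟨k₁, h₁⟩ := ih
    exact ⟨k₁, fun k hk w hw => inv_mem (h₁ k hk w hw)⟩
  | mul y z _ _ ihy ihz =>
    obtain ⟨k₁, h₁⟩ := ihy
    obtain ⟨k₂, h₂⟩ := ihz
    exact ⟨max k₁ k₂, fun k hk w hw => mul_mem (h₁ k (le_of_max_le_left hk) w hw)
      (h₂ k (le_of_max_le_right hk) w hw)⟩

theorem IntermediateField.exists_common_denominator {σ : Type*} (v : σ → Ω) (Z : Finset Ω)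
    (hZ : ∀ z ∈ Z, z ∈ adjoin K (Set.range v)) :
    ∃ q : MvPolynomial σ K, MvPolynomial.aeval v q ≠ 0 ∧
      ∀ z ∈ Z, ∃ a : MvPolynomial σ K, z * MvPolynomial.aeval v q = MvPolynomial.aeval v a := by
  classical
  induction Z using Finset.induction_on with
  | empty => exact ⟨1, by simp, by simp⟩
  | insert y Z _ ih =>
    obtain ⟨q, hq, hqZ⟩ := ih fun z hz => hZ z (Finset.mem_insert_of_mem hz)
    obtain ⟨r, s, hrs⟩ := (mem_adjoin_range_iff K v y).mp (hZ y (Finset.mem_insert_self _ _))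
    by_cases hs : MvPolynomial.aeval v s = 0
    -- Division by zero makes `y = 0`, so the numerator `0` serves.
    · refine ⟨q, hq, fun z hz => ?_⟩
      rcases Finset.mem_insert.mp hz with rfl | hz
      · exact ⟨0, by simp [hrs, hs]⟩
      · exact hqZ z hz
    · refine ⟨s * q, by simp [hs, hq], fun z hz => ?_⟩
      rcases Finset.mem_insert.mp hz with rfl | hz
      · exact ⟨r * q, by rw [hrs, map_mul, map_mul]; field_simp⟩
      · obtain ⟨a, ha⟩ := hqZ z hz
        exact ⟨s * a, by rw [map_mul, map_mul, ← ha]; ring⟩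

end PerfectClosureOfSimpleExtension

/-! ### Étale algebras over polynomial rings and their specialization. -/

section EtaleOverPolynomialRing

open IntermediateField

/-- Over a perfect field a separating transcendence basis exists; above it `F` is finite separable.
-/
theorem exists_algebraicIndependent_and_etale_of_perfectField (L F : Type*) [Field L] [Field F]
    [Algebra L F] [PerfectField L] [Algebra.EssFiniteType L F] :
    ∃ s : Finset F, AlgebraicIndependent L ((↑) : s → F) ∧
      Algebra.Etale (IntermediateField.adjoin L (s : Set F)) F := by
  obtain ⟨s, hs, hsep⟩ := exists_isTranscendenceBasis_and_isSeparable_of_perfectField L F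
  let E := IntermediateField.adjoin L (s : Set F)
  have : Algebra.FormallyEtale E F := .of_isSeparable E F
  have : Algebra.EssFiniteType E F := .of_comp L E F
  have : Module.Finite E F := Algebra.FormallyUnramified.finite_of_free E F
  exact ⟨s, hs.1, inferInstance, Algebra.FinitePresentation.of_finiteType.mp inferInstance⟩

/-- If an element `x₀` of a perfect extension field is transcendental, any finitely generated
algebra over the base field in which `x₀` lies maps to an étale algebra over a polynomial ring,
one of whose variables is a `p ^ k`-th root of `x₀`. -/
theorem Algebra.FiniteType.exists_etale_mvPolynomial {K D Ω : Type u} [Field K] [PerfectField K]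
    (p : ℕ) [ExpChar K p] [CommRing D] [Algebra K D] [Algebra.FiniteType K D] [Field Ω]
    [Algebra K Ω] [PerfectField Ω] (x : D) (i : D →ₐ[K] Ω) (hx : Transcendental K (i x)) :
    ∃ (σ : Type u) (_ : Finite σ) (k : ℕ) (B : Type u) (_ : CommRing B) (_ : Algebra K B)
      (_ : Algebra (MvPolynomial (σ ⊕ Unit) K) B) (_ : IsScalarTower K (MvPolynomial (σ ⊕ Unit) K) B)
      (_ : B →ₐ[K] Ω) (j : D →ₐ[K] B), Algebra.Etale (MvPolynomial (σ ⊕ Unit) K) B ∧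
      j x = algebraMap (MvPolynomial (σ ⊕ Unit) K) B (.X (.inr ())) ^ p ^ k := by
  classical
  have := expChar_of_injective_algebraMap (algebraMap K Ω).injective p
  obtain ⟨S, hS⟩ := Algebra.FiniteType.out (R := K) (A := D)
  -- A perfect base containing `x`: the basis chosen over it stays independent of the roots of `x`.
  let L := perfectClosure K⟮i x⟯ Ω
  have : IsScalarTower K L Ω := .of_algebraMap_eq fun _ => rfl
  let F : IntermediateField L Ω := IntermediateField.adjoin L (S.image i : Set Ω)
  have : Algebra.EssFiniteType L F := IntermediateField.essFiniteType_iff.mpr ⟨_, rfl⟩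
  obtain ⟨s, hs, hsep⟩ := exists_algebraicIndependent_and_etale_of_perfectField L F
  let E := IntermediateField.adjoin L (s : Set F)
  have : IsScalarTower K E F := .of_algebraMap_eq fun _ => rfl
  have hi : ∀ d, i d ∈ F := by
    have h : i.range ≤ (F.restrictScalars K).toSubalgebra := by
      rw [← Algebra.map_top, ← hS, AlgHom.map_adjoin, Algebra.adjoin_le_iff]
      rintro _ ⟨d, hd, rfl⟩
      exact IntermediateField.subset_adjoin L _ (Finset.mem_coe.mpr (Finset.mem_image_of_mem i hd))
    exact fun d => h ⟨d, rfl⟩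
  let i' : D →ₐ[K] F := i.codRestrict (F.restrictScalars K).toSubalgebra hi
  obtain ⟨Z, hZ⟩ := Algebra.Etale.exists_finset_descent (E := E) i'
  have hZt : ∀ z ∈ Z, (z : F) ∈ IntermediateField.adjoin L (Set.range ((↑) : s → F)) := fun z _ => by
    simp
  choose! k₀ hk₀ using fun z (hz : z ∈ Z) => exists_forall_mem_adjoin_root p F _ (hZt z hz)
  -- Large enough that every element of `Z` lies in the field generated over `K` by `s` and `w`.
  let k := Z.sup k₀
  let w : Ω := (iterateFrobeniusEquiv Ω p k).symm (i x)
  have hw : w ^ p ^ k = i x := by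
    rw [← iterateFrobeniusEquiv_def, RingEquiv.apply_symm_apply]
  have := expChar_of_injective_algebraMap (algebraMap K K⟮i x⟯).injective p
  have hwL : w ∈ L := (mem_perfectClosure_iff_pow_mem p).mpr
    ⟨k, ⟨i x, mem_adjoin_simple_self K _⟩, hw.symm⟩
  let v : s ⊕ Unit → E := Sum.elim (fun t => ⟨t, IntermediateField.subset_adjoin L _ t.2⟩)
    fun _ => algebraMap L E ⟨w, hwL⟩
  have hv : AlgebraicIndependent K v := by
    have hwt : AlgebraicIndependent K fun _ : Unit => (⟨w, hwL⟩ : L) := by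
      rw [algebraicIndependent_unique_type_iff]
      intro h
      refine hx ?_
      rw [← hw]
      exact (h.algHom (IsScalarTower.toAlgHom K L Ω)).pow _
    have : IsScalarTower K L F := .of_algebraMap_eq fun _ => rfl
    refine .of_comp (IsScalarTower.toAlgHom K E F) ?_
    convert hwt.sumElim_comp hs using 1
    ext (_ | _) <;> rfl
  obtain ⟨q, hq, hqZ⟩ := IntermediateField.exists_common_denominator (K := K)
    (Sum.elim (fun t : s => ((t : F) : Ω)) fun _ : Unit => w) (Z.image fun z : E => ((z : F) : Ω)) (by
      simp only [Finset.forall_mem_image]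
      exact fun z hz => hk₀ z hz k (Finset.le_sup hz) w hw)
  have hcoe : ∀ a : MvPolynomial (s ⊕ Unit) K, ((MvPolynomial.aeval v a : E) : Ω) =
      MvPolynomial.aeval (Sum.elim (fun t : s => ((t : F) : Ω)) fun _ : Unit => w) a := by
    intro a
    have h := MvPolynomial.comp_aeval_apply v
      ((F.restrictScalars K).val.comp (IsScalarTower.toAlgHom K E F)) a
    refine h.trans (congr(MvPolynomial.aeval $(?_) a))
    ext (_ | _) <;> rfl
  obtain ⟨B, _, _, _, _, ι, j, _, hι, hij, hιφ⟩ := hZ (MvPolynomial (s ⊕ Unit) K)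
    (MvPolynomial.aeval v) hv q (fun h => hq (by rw [← hcoe, h]; rfl)) (by
      intro z hz
      obtain ⟨a, ha⟩ := hqZ _ (Finset.mem_image_of_mem _ hz)
      refine ⟨a, Subtype.ext (Subtype.ext ?_)⟩
      rw [hcoe, ← ha, ← hcoe]
      rfl)
  refine ⟨s, inferInstance, k, B, inferInstance, inferInstance, inferInstance, inferInstance,
    ((F.restrictScalars K).val.comp ι), j, inferInstance, hι ?_⟩
  rw [map_pow, hιφ, MvPolynomial.aeval_X]
  refine (congr($hij x)).trans (Subtype.ext hw.symm)

end EtaleOverPolynomialRing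

/-- Specialising all but the last variable of an étale algebra over a polynomial ring at the
coordinates of a rational point yields an étale algebra over the affine line with a rational
point. -/
theorem Algebra.Etale.exists_specialization {K σ B : Type u} [Field K] [CommRing B] [Algebra K B]
    [Algebra (MvPolynomial (σ ⊕ Unit) K) B] [IsScalarTower K (MvPolynomial (σ ⊕ Unit) K) B]
    [Algebra.Etale (MvPolynomial (σ ⊕ Unit) K) B] (χ : B →ₐ[K] K) :
    ∃ (A : Type u) (_ : CommRing A) (_ : Algebra K A) (_ : Algebra K[X] A)
      (_ : IsScalarTower K K[X] A) (_ : A →ₐ[K] K) (j : B →ₐ[K] A), Algebra.Etale K[X] A ∧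
      j (algebraMap (MvPolynomial (σ ⊕ Unit) K) B (.X (.inr ()))) =
        algebraMap K[X] A Polynomial.X := by
  let τ (i : σ ⊕ Unit) : K := χ (algebraMap (MvPolynomial (σ ⊕ Unit) K) B (.X i))
  let φ : MvPolynomial (σ ⊕ Unit) K →ₐ[K] K[X] :=
    MvPolynomial.aeval (Sum.elim (fun i => Polynomial.C (τ (.inl i))) fun _ => Polynomial.X)
  obtain ⟨A, _, _, j, hA, hj, hlift⟩ := Algebra.Etale.exists_pushout (A := B) φ.toRingHom
  let := Algebra.compHom A (algebraMap K K[X])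
  have : IsScalarTower K K[X] A := .of_algebraMap_eq fun _ => rfl
  have hjp (q : MvPolynomial (σ ⊕ Unit) K) : j (algebraMap _ B q) = algebraMap K[X] A (φ q) :=
    congr($hj q)
  have hχφ : χ.comp (IsScalarTower.toAlgHom K (MvPolynomial (σ ⊕ Unit) K) B) =
      (Polynomial.aeval (τ (.inr ()))).comp φ :=
    MvPolynomial.algHom_ext fun i => by rcases i with i | i <;> simp [φ, τ]
  obtain ⟨h, hh, -⟩ := hlift (Polynomial.aeval (τ (.inr ())) : K[X] →ₐ[K] K).toRingHom χ.toRingHom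
    (congrArg AlgHom.toRingHom hχφ)
  refine ⟨A, inferInstance, inferInstance, inferInstance, inferInstance, ⟨h, fun r => ?_⟩,
    ⟨j, fun r => ?_⟩, hA, ?_⟩
  · exact congr($hh (algebraMap K K[X] r)).trans (AlgHom.commutes _ r)
  · change j (algebraMap K B r) = _
    rw [IsScalarTower.algebraMap_apply K (MvPolynomial (σ ⊕ Unit) K) B, hjp,
      IsScalarTower.algebraMap_apply K K[X] A]
    exact congr(algebraMap K[X] A $(φ.commutes r))
  · exact (hjp _).trans (by simp [φ])

theorem Algebra.FiniteType.exists_etale_polynomial {K D : Type u} [Field K] [PerfectField K]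
    (p : ℕ) [ExpChar K p] [CommRing D] [Algebra K D] [Algebra.FiniteType K D] (x : D)
    (hx : (Set.range fun f : D →ₐ[K] K => f x).Infinite) :
    ∃ (A : Type u) (_ : CommRing A) (_ : Algebra K A) (_ : Algebra K[X] A)
      (_ : IsScalarTower K K[X] A) (_ : A →ₐ[K] K) (k : ℕ) (j : D →ₐ[K] A), Algebra.Etale K[X] A ∧
      j x = algebraMap K[X] A Polynomial.X ^ p ^ k := by
  obtain ⟨Ω, _, _, i, _, hi, hΩ⟩ := exists_transcendental_of_infinite_range x hx
  obtain ⟨σ, _, k, B, _, _, _, _, ι, j, _, hj⟩ := exists_etale_mvPolynomial p x i hi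
  have : Algebra.FiniteType K B :=
    .trans (inferInstance : Algebra.FiniteType K (MvPolynomial (σ ⊕ Unit) K)) inferInstance
  -- Existential closedness turns the `Ω`-point of `B` into a `K`-point.
  obtain ⟨χ⟩ := hΩ B ι
  obtain ⟨A, _, _, _, _, ψ, l, hA, hl⟩ := Algebra.Etale.exists_specialization (σ := σ) χ
  exact ⟨A, inferInstance, inferInstance, inferInstance, inferInstance, ψ, k, l.comp j, hA, by
    rw [AlgHom.comp_apply, hj, map_pow, hl]⟩

end

/-! ### The main theorem. -/

theorem mainTheorem5 {K : Type u} [Field K] [FirstOrder.Ring.CompatibleRing K] [PerfectField K]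
    (hK : IsAmpleField K) (X : Set K)
    (hX : IsExistentiallyDefinable FirstOrder.Language.ring (Set.univ : Set K) X) (hinf : X.Infinite)
    (K₁ : Subfield K) (hK₁ : K₁ ≠ ⊤) :
    Cardinal.mk ↥(X \ (K₁ : Set K)) = Cardinal.mk K := by
  obtain ⟨p, _⟩ := ExpChar.exists K
  have : Infinite K := Set.infinite_univ_iff.mp (hinf.mono (Set.subset_univ X))
  obtain ⟨D, _, _, x, _, rfl⟩ := hX.exists_algebra
  obtain ⟨A, _, _, _, _, χ, k, j, _, hj⟩ := Algebra.FiniteType.exists_etale_polynomial p x hinf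
  -- `t ^ p ^ k` avoids `K₁` exactly when `t` avoids this preimage, which is proper because
  -- Frobenius is surjective on `K`.
  have hK₂ : K₁.comap (iterateFrobenius K p k) ≠ ⊤ := by
    intro h
    refine hK₁ (eq_top_iff.mpr fun y _ => ?_)
    have : (iterateFrobeniusEquiv K p k).symm y ∈ K₁.comap (iterateFrobenius K p k) := h ▸ trivial
    rwa [Subfield.mem_comap, ← iterateFrobeniusEquiv_apply, RingEquiv.apply_symm_apply] at this
  refine le_antisymm (Cardinal.mk_set_le _) ?_
  rw [← hK.mk_rationalValues_diff χ _ hK₂]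
  refine Cardinal.mk_le_of_injective (f := fun y => ⟨iterateFrobenius K p k y, ?_, y.2.2⟩) ?_
  · obtain ⟨g, hg⟩ := y.2.1
    refine ⟨g.comp j, ?_⟩
    simp only [AlgHom.comp_apply, hj, map_pow, ← hg, iterateFrobenius_def]
  · intro y z h
    exact Subtype.ext (iterateFrobenius_inj K p k congr(($h : K)))
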